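/- **Theorem 3.4 (Hutton's theorem revisited).** Let $X$ be a real or complex Banach space and let $T \colon X \to X$ be a compact linear operator. Let $X^*$ be the dual space of $X$, with the operator norm, and let $T^* \colon X^* \to X^*$, $T^* f = f \circ T$, be the adjoint of $T$. For a bounded linear operator $S \colon E \to F$ between normed spaces and $n = 0, 1, 2, \dots$ let $$\alpha_n(S) = \inf\{\|S - A\| : A \colon E \to F \text{ bounded and linear},\ \operatorname{rank} A \le n\}$$ be the $n$-th approximation number of $S$. Then $$\alpha_n(T) = \alpha_n(T^*) \qquad \text{for every } n = 0, 1, 2, \dots$$ -/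

import Mathlib

/-- The `n`-th approximation number `α_n(T) = inf {‖T - A‖ : A ∈ L(E, F), rank A ≤ n}`
(`n = 0, 1, 2, …`, so `α_0(T) = ‖T‖`) of a bounded operator `T` from `E` to `F`. The infimum is
taken over a set of nonnegative reals that contains `‖T‖` (take `A = 0`). -/
noncomputable def approximationNumber {𝕜 E F : Type*} [RCLike 𝕜]
    [NormedAddCommGroup E] [NormedSpace 𝕜 E] [NormedAddCommGroup F] [NormedSpace 𝕜 F]
    (n : ℕ) (T : E →L[𝕜] F) : ℝ :=
  sInf {r : ℝ | ∃ A : E →L[𝕜] F, (A : E →ₗ[𝕜] F).rank ≤ (n : Cardinal) ∧ r = ‖T - A‖}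

/-- The Banach space adjoint `T* : F* → E*`, `T* f = f ∘ T`, of a bounded operator `T` from `E`
to `F`. The dual spaces carry the operator norm. -/
noncomputable def banachAdjoint {𝕜 E F : Type*} [RCLike 𝕜]
    [NormedAddCommGroup E] [NormedSpace 𝕜 E] [NormedAddCommGroup F] [NormedSpace 𝕜 F]
    (T : E →L[𝕜] F) : StrongDual 𝕜 F →L[𝕜] StrongDual 𝕜 E :=
  T.precomp 𝕜

/-!
The inequality `α_n(T*) ≤ α_n(T)` holds for every bounded `T`: passing to adjoints does not increase
norms, and the adjoint of `x ↦ ∑ k, φ k x • f k` is `g ↦ ∑ k, g (f k) • φ k`, so ranks do not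
increase either (`rank_le_iff_exists_eq_sum`).

For the reverse inequality let `A` be an operator between the duals, `A g = ∑ k, φ k g • f k`, where
the `φ k` lie in the bidual of the target. If all `φ k` came from vectors `y k`, then `A` would be
the adjoint of `B x = ∑ k, f k x • y k` and `‖T - B‖ = ‖T* - A‖`. In general, the `φ k` are replaced
by vectors `y k` that satisfy finitely many of the norm inequalities which the `φ k` satisfy, with
an arbitrarily small loss: by Hahn-Banach separation, every finite system of strict inequalities
`‖u i - ∑ k, c i k • z k‖ < r i` which is solvable for `z k` in the bidual is solvable in the space
itself (`exists_norm_sub_sum_lt`). This is the only part of the principle of local reflexivity that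
is needed. As `T` is compact, the vectors `(T x, (f k x)_k)` with `‖x‖ ≤ 1` form a totally bounded
set, so that finitely many inequalities control `‖T x - B x‖` for all these `x`
(`exists_norm_sub_sum_smulRight_le`).
-/

open NormedSpace in
/-- A Helly type lemma: a finite system of strict norm inequalities in finitely many unknowns with
coefficients in a normed space is solvable in that space if it is solvable in the bidual. -/
theorem exists_norm_sub_sum_lt {𝕜 E ι κ : Type*} [RCLike 𝕜] [NormedAddCommGroup E]
    [NormedSpace 𝕜 E] [Fintype ι] [Fintype κ] (u : ι → E) (c : ι → κ → 𝕜)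
    (φ : κ → StrongDual 𝕜 (StrongDual 𝕜 E)) (r : ι → ℝ)
    (h : ∀ i, ‖inclusionInDoubleDual 𝕜 E (u i) - ∑ k, c i k • φ k‖ < r i) :
    ∃ y : κ → E, ∀ i, ‖u i - ∑ k, c i k • y k‖ < r i := by
  classical
  let : NormedSpace ℝ E := NormedSpace.restrictScalars ℝ 𝕜 E
  have : IsScalarTower ℝ 𝕜 E := RestrictScalars.isScalarTower ℝ 𝕜 E
  have hr : ∀ i, 0 < r i := fun i => (ContinuousLinearMap.opNorm_nonneg _).trans_lt (h i)
  -- The right-hand sides `w` for which the system is solvable form an open convex set `C`.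
  set C : Set (ι → E) := {w | ∃ y : κ → E, ∀ i, ‖w i - ∑ k, c i k • y k‖ < r i} with hC
  by_contra hu
  have hopen : IsOpen C := by
    have : C = ⋃ y : κ → E, ⋂ i, {w | ‖w i - ∑ k, c i k • y k‖ < r i} := by
      ext w; simp [hC]
    rw [this]
    refine isOpen_iUnion fun y => isOpen_iInter_of_finite fun i => ?_
    exact isOpen_lt (by fun_prop) continuous_const
  have hconv : Convex ℝ C := by
    rintro w ⟨y, hy⟩ w' ⟨y', hy'⟩ a b ha hb hab
    refine ⟨a • y + b • y', fun i => ?_⟩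
    have e : (a • w + b • w') i - ∑ k, c i k • (a • y + b • y') k
        = a • (w i - ∑ k, c i k • y k) + b • (w' i - ∑ k, c i k • y' k) := by
      simp only [Pi.add_apply, Pi.smul_apply, smul_add, Finset.sum_add_distrib, smul_sub,
        Finset.smul_sum, smul_comm _ (c i _)]
      abel
    rw [e]
    have hball := convex_ball (0 : E) (r i)
    simpa using hball (by simpa using hy i) (by simpa using hy' i) ha hb hab
  obtain ⟨f, hf⟩ := RCLike.geometric_hahn_banach_open_point (𝕜 := 𝕜) hconv hopen
    (show u ∉ C from hu)
  set g : ι → StrongDual 𝕜 E :=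
    fun i => f.comp (ContinuousLinearMap.single 𝕜 (fun _ : ι => E) i) with hg
  have hfg : ∀ w, f w = ∑ i, g i (w i) := fun w => by
    conv_lhs => rw [← Finset.univ_sum_single w]
    simp [hg]
  -- A functional whose real part is bounded above on a subspace vanishes there.
  have hzero : ∀ y : κ → E, f (fun i => ∑ k, c i k • y k) = 0 := by
    intro y
    by_contra hne
    set a := f (fun i => ∑ k, c i k • y k) with ha
    set t : 𝕜 := (RCLike.re (f u) : 𝕜) * a⁻¹ with ht
    have h1 := hf (t • fun i => ∑ k, c i k • y k)
      ⟨t • y, fun i => by simpa [Finset.smul_sum, smul_comm _ t] using hr i⟩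
    rw [map_smul, ← ha, smul_eq_mul, ht, inv_mul_cancel_right₀ hne, RCLike.ofReal_re] at h1
    exact lt_irrefl _ h1
  have hsum : ∀ k, ∑ i, c i k • g i = 0 := by
    intro k
    ext x
    have := hzero (Pi.single k x)
    rw [hfg] at this
    simpa [Pi.single_apply] using this
  -- The unknowns cancel, so `f u` depends only on the residuals of the bidual solution.
  have hfu : f u = ∑ i, (inclusionInDoubleDual 𝕜 E (u i) - ∑ k, c i k • φ k) (g i) := by
    have e : ∑ i, (∑ k, c i k • φ k) (g i) = 0 := by
      have : ∑ i, (∑ k, c i k • φ k) (g i) = ∑ k, φ k (∑ i, c i k • g i) := by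
        simp only [sum_apply, smul_apply, map_sum, map_smul]
        exact Finset.sum_comm
      rw [this]
      simp [hsum]
    simp only [sub_apply, Finset.sum_sub_distrib, e, sub_zero, dual_def, hfg]
  have hv : ∀ i, ∃ v : E, ‖v‖ < r i ∧
      ‖inclusionInDoubleDual 𝕜 E (u i) - ∑ k, c i k • φ k‖ * ‖g i‖ ≤ RCLike.re (g i v) := by
    intro i
    set s := ‖inclusionInDoubleDual 𝕜 E (u i) - ∑ k, c i k • φ k‖ with hs
    rcases eq_or_ne (g i) 0 with h0 | h0
    · exact ⟨0, by simpa using hr i, by simp [h0]⟩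
    have hlt : s / r i * ‖g i‖ < ‖g i‖ :=
      mul_lt_of_lt_one_left (norm_pos_iff.2 h0) ((div_lt_one (hr i)).2 (h i))
    obtain ⟨x, hx, hgx⟩ := (g i).exists_lt_apply_of_lt_opNorm hlt
    obtain ⟨z, hz, hzx⟩ := RCLike.exists_norm_eq_mul_self (g i x)
    refine ⟨((r i : 𝕜) * z) • x, ?_, ?_⟩
    · rw [norm_smul, norm_mul, hz, RCLike.norm_ofReal, abs_of_pos (hr i), mul_one]
      exact mul_lt_of_lt_one_right (hr i) hx
    · rw [map_smul, smul_eq_mul, mul_assoc, ← hzx, ← RCLike.ofReal_mul, RCLike.ofReal_re]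
      have := mul_le_mul_of_nonneg_left hgx.le (hr i).le
      rwa [← mul_assoc, mul_div_cancel₀ _ (hr i).ne'] at this
  choose v hv hgv using hv
  have h1 := hf v ⟨0, fun i => by simpa using hv i⟩
  have h2 : RCLike.re (f u) ≤ RCLike.re (f v) := by
    calc RCLike.re (f u) ≤ ‖f u‖ := RCLike.re_le_norm _
      _ ≤ ∑ i, ‖inclusionInDoubleDual 𝕜 E (u i) - ∑ k, c i k • φ k‖ * ‖g i‖ := by
        rw [hfu]
        exact (norm_sum_le _ _).trans (Finset.sum_le_sum fun i _ => ContinuousLinearMap.le_opNorm _ _)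
      _ ≤ ∑ i, RCLike.re (g i (v i)) := Finset.sum_le_sum fun i _ => hgv i
      _ = RCLike.re (f v) := by rw [hfg v, map_sum]
  exact absurd h1 h2.not_gt

section

variable {𝕜 E F : Type*} [RCLike 𝕜] [NormedAddCommGroup E] [NormedSpace 𝕜 E]
  [NormedAddCommGroup F] [NormedSpace 𝕜 F]

theorem rank_le_iff_exists_eq_sum (A : E →L[𝕜] F) (n : ℕ) :
    (A : E →ₗ[𝕜] F).rank ≤ (n : Cardinal) ↔
      ∃ m ≤ n, ∃ (φ : Fin m → StrongDual 𝕜 E) (f : Fin m → F),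
        A = ∑ k, (φ k).smulRight (f k) := by
  constructor
  · intro h
    set V := LinearMap.range (A : E →ₗ[𝕜] F) with hV
    have : FiniteDimensional 𝕜 V := Module.rank_lt_aleph0_iff.1
      (lt_of_le_of_lt h Cardinal.natCast_lt_aleph0)
    let b := Module.finBasis 𝕜 V
    refine ⟨Module.finrank 𝕜 V, ?_,
      fun k => (LinearMap.toContinuousLinearMap (b.coord k)).comp
        (A.codRestrict V fun x => ⟨x, rfl⟩), fun k => (b k : F), ?_⟩
    · exact Module.finrank_le_of_rank_le h
    · ext x
      have := congrArg V.subtype (b.sum_repr (A.codRestrict V (fun x => ⟨x, rfl⟩) x))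
      rw [map_sum] at this
      rw [sum_apply]
      exact this.symm
  · rintro ⟨m, hm, φ, f, rfl⟩
    have hle : LinearMap.range ((∑ k, (φ k).smulRight (f k) : E →L[𝕜] F) : E →ₗ[𝕜] F)
        ≤ Submodule.span 𝕜 (Set.range f) := by
      rintro _ ⟨x, rfl⟩
      simp only [ContinuousLinearMap.coe_coe, sum_apply,
        ContinuousLinearMap.smulRight_apply]
      exact Submodule.sum_mem _ fun k _ =>
        Submodule.smul_mem _ _ (Submodule.subset_span ⟨k, rfl⟩)
    have : FiniteDimensional 𝕜 (Submodule.span 𝕜 (Set.range f)) :=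
      FiniteDimensional.span_of_finite 𝕜 (Set.finite_range f)
    refine (Submodule.rank_mono hle).trans ?_
    rw [← Module.finrank_eq_rank]
    have := (finrank_range_le_card (R := 𝕜) f).trans (by simpa using hm)
    exact_mod_cast this

theorem approximationNumber_le {n : ℕ} (T A : E →L[𝕜] F)
    (hA : (A : E →ₗ[𝕜] F).rank ≤ (n : Cardinal)) : approximationNumber n T ≤ ‖T - A‖ :=
  csInf_le ⟨0, by rintro _ ⟨B, -, rfl⟩; exact norm_nonneg _⟩ ⟨A, hA, rfl⟩

theorem le_approximationNumber {n : ℕ} {T : E →L[𝕜] F} {a : ℝ}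
    (h : ∀ A : E →L[𝕜] F, (A : E →ₗ[𝕜] F).rank ≤ (n : Cardinal) → a ≤ ‖T - A‖) :
    a ≤ approximationNumber n T := by
  refine le_csInf ⟨‖T - 0‖, 0, by simp, rfl⟩ ?_
  rintro _ ⟨A, hA, rfl⟩
  exact h A hA

theorem norm_banachAdjoint_le (T : E →L[𝕜] F) : ‖banachAdjoint T‖ ≤ ‖T‖ :=
  ContinuousLinearMap.opNorm_le_bound _ (norm_nonneg _) fun g =>
    (ContinuousLinearMap.opNorm_comp_le g T).trans_eq (mul_comm _ _)

theorem approximationNumber_banachAdjoint_le (T : E →L[𝕜] F) (n : ℕ) :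
    approximationNumber n (banachAdjoint T) ≤ approximationNumber n T := by
  refine le_approximationNumber fun A hA => ?_
  have hsub : banachAdjoint T - banachAdjoint A = banachAdjoint (T - A) := by
    ext g x
    simp [banachAdjoint]
  refine (approximationNumber_le _ (banachAdjoint A) ?_).trans
    (hsub ▸ norm_banachAdjoint_le (T - A))
  obtain ⟨m, hm, φ, f, rfl⟩ := (rank_le_iff_exists_eq_sum A n).1 hA
  refine (rank_le_iff_exists_eq_sum _ n).2
    ⟨m, hm, fun k => NormedSpace.inclusionInDoubleDual 𝕜 F (f k), φ, ?_⟩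
  ext g x
  simp [banachAdjoint, mul_comm]

/-- A finite rank approximation `∑ k, φ k • f k` of the adjoint of a compact operator `T` yields an
equally good approximation of `T` itself, up to `ε`, by an operator with the same functionals
`f k`. -/
theorem exists_norm_sub_sum_smulRight_le {T : E →L[𝕜] F} (hT : IsCompactOperator T) {m : ℕ}
    (φ : Fin m → StrongDual 𝕜 (StrongDual 𝕜 F)) (f : Fin m → StrongDual 𝕜 E) {ε : ℝ} (hε : 0 < ε) :
    ∃ y : Fin m → F, ‖T - ∑ k, (f k).smulRight (y k)‖
      ≤ ‖banachAdjoint T - ∑ k, (φ k).smulRight (f k)‖ + ε := by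
  set r := ‖banachAdjoint T - ∑ k, (φ k).smulRight (f k)‖ with hr
  set M : ℝ := ∑ k, (‖φ k‖ + 1) with hM
  have hM0 : 0 ≤ M := Finset.sum_nonneg fun k _ => by positivity
  -- `M` bounds `∑ k, ‖y k‖` in advance, so the mesh `δ` of the net can be chosen before the `y k`.
  set δ : ℝ := ε / 2 / (1 + M) with hδ
  have hδ0 : 0 < δ := by positivity
  set P : E → F × (Fin m → 𝕜) := fun x => (T x, fun k => f k x) with hP
  have htb : TotallyBounded (P '' Metric.closedBall 0 1) := by
    obtain ⟨K, hK, hTK⟩ := IsCompactOperator.image_closedBall_subset_compact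
      (f := (T : E →ₗ[𝕜] F)) hT 1
    have hc : IsCompact (K ×ˢ Metric.closedBall (0 : Fin m → 𝕜) (∑ k, ‖f k‖)) :=
      hK.prod (isCompact_closedBall _ _)
    refine hc.totallyBounded.subset ?_
    rintro _ ⟨x, hx, rfl⟩
    refine ⟨hTK ⟨x, hx, rfl⟩, ?_⟩
    rw [mem_closedBall_zero_iff] at hx ⊢
    refine (pi_norm_le_iff_of_nonneg (by positivity)).2 fun k => ?_
    exact ((f k).unit_le_opNorm x hx).trans
      (Finset.single_le_sum (f := fun k => ‖f k‖) (fun _ _ => norm_nonneg _) (Finset.mem_univ k))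
  obtain ⟨t, hts, htf, htc⟩ := Metric.finite_approx_of_totallyBounded htb δ hδ0
  have := htf.fintype
  -- The points of the net give one family of inequalities, the bounds on `‖y k‖` another.
  obtain ⟨y, hy⟩ := exists_norm_sub_sum_lt (ι := t ⊕ Fin m)
    (Sum.elim (fun p => p.1.1) fun _ => 0)
    (Sum.elim (fun p => p.1.2) fun k => Pi.single k 1) φ
    (Sum.elim (fun _ => r + ε / 2) fun k => ‖φ k‖ + 1) (by
      rintro (⟨p, hp⟩ | k)
      · obtain ⟨x, hx, rfl⟩ := hts hp
        rw [mem_closedBall_zero_iff] at hx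
        refine lt_of_le_of_lt ?_ (lt_add_of_pos_right r (half_pos hε))
        refine ContinuousLinearMap.opNorm_le_bound _ (ContinuousLinearMap.opNorm_nonneg _) fun g => ?_
        have e : (NormedSpace.inclusionInDoubleDual 𝕜 F (T x) - ∑ k, f k x • φ k) g
            = (banachAdjoint T - ∑ k, (φ k).smulRight (f k)) g x := by
          simp [banachAdjoint, mul_comm]
        simp only [Sum.elim_inl, hP]
        rw [e]
        exact (ContinuousLinearMap.unit_le_opNorm _ x hx).trans (ContinuousLinearMap.le_opNorm _ g)
      · have e : NormedSpace.inclusionInDoubleDual 𝕜 F 0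
            - ∑ j, (Pi.single k 1 : Fin m → 𝕜) j • φ j = -φ k := by
          ext g
          simp only [sub_apply, sum_apply, smul_apply]
          simp [Pi.single_apply]
        simp only [Sum.elim_inr]
        rw [e, ContinuousLinearMap.opNorm_neg]
        exact lt_add_one _)
  have hyt : ∀ p ∈ t, ‖p.1 - ∑ k, p.2 k • y k‖ < r + ε / 2 := fun p hp => hy (Sum.inl ⟨p, hp⟩)
  have hyM : ∑ k, ‖y k‖ ≤ M := Finset.sum_le_sum fun k _ => by
    simpa [Pi.single_apply] using (hy (Sum.inr k)).le
  refine ⟨y, ContinuousLinearMap.opNorm_le_of_unit_norm (by positivity) fun x hx => ?_⟩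
  obtain ⟨p, hp, hxp⟩ := Set.mem_iUnion₂.1 (htc ⟨x, by simp [hx], rfl⟩)
  have hxp1 : ‖T x - p.1‖ ≤ δ := by
    rw [← dist_eq_norm]; exact (le_max_left _ _).trans hxp.le
  have hxp2 : ∀ k, ‖f k x - p.2 k‖ ≤ δ := fun k => by
    rw [← dist_eq_norm]
    exact (dist_le_pi_dist (fun k => f k x) p.2 k).trans ((le_max_right _ _).trans hxp.le)
  have e : (T - ∑ k, (f k).smulRight (y k)) x
      = (T x - p.1) + (p.1 - ∑ k, p.2 k • y k) - ∑ k, (f k x - p.2 k) • y k := by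
    simp [sub_smul, Finset.sum_sub_distrib]
  have h3 : ‖∑ k, (f k x - p.2 k) • y k‖ ≤ δ * M :=
    calc ‖∑ k, (f k x - p.2 k) • y k‖ ≤ ∑ k, δ * ‖y k‖ :=
          norm_sum_le_of_le _ fun k _ => by
            rw [norm_smul]; exact mul_le_mul_of_nonneg_right (hxp2 k) (norm_nonneg _)
      _ ≤ δ * M := by
          rw [← Finset.mul_sum]; exact mul_le_mul_of_nonneg_left hyM hδ0.le
  have hδM : δ + δ * M = ε / 2 := by
    rw [hδ]; field_simp
  rw [e]
  calc _ ≤ ‖T x - p.1‖ + ‖p.1 - ∑ k, p.2 k • y k‖ + ‖∑ k, (f k x - p.2 k) • y k‖ :=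
        (norm_sub_le _ _).trans (add_le_add_left (norm_add_le _ _) _)
    _ ≤ r + ε := by linarith [hyt p hp]

theorem approximationNumber_le_banachAdjoint {T : E →L[𝕜] F} (hT : IsCompactOperator T) (n : ℕ) :
    approximationNumber n T ≤ approximationNumber n (banachAdjoint T) := by
  refine le_approximationNumber fun A hA => le_of_forall_pos_le_add fun ε hε => ?_
  obtain ⟨m, hm, φ, f, rfl⟩ := (rank_le_iff_exists_eq_sum A n).1 hA
  obtain ⟨y, hy⟩ := exists_norm_sub_sum_smulRight_le hT φ f hε
  exact (approximationNumber_le T _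
    ((rank_le_iff_exists_eq_sum _ n).2 ⟨m, hm, f, y, rfl⟩)).trans hy

end

theorem theorem3p4 {𝕜 X : Type*} [RCLike 𝕜] [NormedAddCommGroup X] [NormedSpace 𝕜 X]
    [CompleteSpace X] (T : X →L[𝕜] X) (hT : IsCompactOperator T) (n : ℕ) :
    approximationNumber n T = approximationNumber n (banachAdjoint T) :=
  (approximationNumber_le_banachAdjoint hT n).antisymm (approximationNumber_banachAdjoint_le T n)
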